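/- Let $\mathbb K$ be an algebraically closed field; algebraic groups are affine and reduced and are identified with their groups of $\mathbb K$-points. Let $G$ be a connected algebraic group over $\mathbb K$ and let $(A,+)$ be a commutative algebraic group over $\mathbb K$ on which $G$ acts algebraically by group automorphisms, that is, $A$ carries an action of the group $G$ by group automorphisms, written $(x,a)\mapsto {}^{x}a$, for which the map $G\times A\to A$ is a morphism of varieties. Let $f:G\dashrightarrow A$ be a rational map, given as a morphism of varieties $\operatorname{dom}(f)\to A$ on a dense open subset $\operatorname{dom}(f)\subseteq G$, such that $$f(xy)=f(x)+{}^{x}f(y)\qquad\text{for all } x,y\in G \text{ with } x,\,y,\,xy\in\operatorname{dom}(f).$$ Then there is a morphism of varieties $\widehat f:G\to A$ that agrees with $f$ on $\operatorname{dom}(f)$ and satisfies $$\widehat f(xy)=\widehat f(x)+{}^{x}\widehat f(y)\qquad\text{for all } x,y\in G.$$ -/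

import Mathlib

/-- The structure of an affine algebraic variety (reduced, not necessarily irreducible) on a set `X`
of points over an algebraically closed field `K`: a finitely generated `K`-algebra `K[X]` of
`K`-valued functions on `X` such that the points of `X` are exactly the `K`-algebra homomorphisms
`K[X] → K`, through evaluation. Equivalently, `X` is identified with a Zariski closed subset of some
`Kⁿ` and `K[X]` consists of the restrictions to it of the polynomials. -/
class AffineVariety (K : Type*) [Field K] (X : Type*) where
  /-- The algebra `K[X]` of regular functions. -/
  coordRing : Subalgebra K (X → K)
  fg : coordRing.FG
  eval_bijective : Function.Bijective
    (fun x : X => ((Pi.evalAlgHom K (fun _ : X => K) x).comp coordRing.val : coordRing →ₐ[K] K))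

namespace AffineVariety

/-- The product variety `X × Y`: its regular functions are the polynomials in the regular functions
on `X` and the regular functions on `Y`, so `K[X × Y] = K[X] ⊗ K[Y]`. -/
instance instProd (K : Type*) [Field K] (X Y : Type*) [AffineVariety K X] [AffineVariety K Y] :
    AffineVariety K (X × Y) where
  coordRing :=
    (coordRing (K := K) (X := X)).map (AlgHom.pi fun p : X × Y => Pi.evalAlgHom K _ p.1) ⊔
    (coordRing (K := K) (X := Y)).map (AlgHom.pi fun p : X × Y => Pi.evalAlgHom K _ p.2)
  fg := (fg.map _).sup (fg.map _)
  eval_bijective := by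
    set a : (X → K) →ₐ[K] (X × Y → K) := AlgHom.pi fun p : X × Y => Pi.evalAlgHom K _ p.1
    set b : (Y → K) →ₐ[K] (X × Y → K) := AlgHom.pi fun p : X × Y => Pi.evalAlgHom K _ p.2
    set A := (coordRing (K := K) (X := X)).map a
    set B := (coordRing (K := K) (X := Y)).map b
    have hA : ∀ f ∈ coordRing (K := K) (X := X), a f ∈ A ⊔ B := fun f hf =>
      (le_sup_left : A ≤ A ⊔ B) ⟨f, hf, rfl⟩
    have hB : ∀ f ∈ coordRing (K := K) (X := Y), b f ∈ A ⊔ B := fun f hf =>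
      (le_sup_right : B ≤ A ⊔ B) ⟨f, hf, rfl⟩
    constructor
    · rintro ⟨x, y⟩ ⟨x', y'⟩ h
      refine Prod.ext ?_ ?_
      · refine eval_bijective (K := K).1 (AlgHom.ext fun f => ?_)
        exact DFunLike.congr_fun h (⟨a f.1, hA f.1 f.2⟩ : (A ⊔ B : Subalgebra K (X × Y → K)))
      · refine eval_bijective (K := K).1 (AlgHom.ext fun f => ?_)
        exact DFunLike.congr_fun h (⟨b f.1, hB f.1 f.2⟩ : (A ⊔ B : Subalgebra K (X × Y → K)))
    · intro φ
      obtain ⟨x, hx⟩ := (eval_bijective (K := K) (X := X)).2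
        (φ.comp ((a.comp (coordRing (K := K) (X := X)).val).codRestrict (A ⊔ B)
          fun f => hA f.1 f.2))
      obtain ⟨y, hy⟩ := (eval_bijective (K := K) (X := Y)).2
        (φ.comp ((b.comp (coordRing (K := K) (X := Y)).val).codRestrict (A ⊔ B)
          fun f => hB f.1 f.2))
      refine ⟨(x, y), ?_⟩
      have key : A ⊔ B ≤ (AlgHom.equalizer
          ((Pi.evalAlgHom K (fun _ : X × Y => K) (x, y)).comp (A ⊔ B).val) φ).map (A ⊔ B).val := by
        refine sup_le ?_ ?_
        · rintro _ ⟨f, hf, rfl⟩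
          exact ⟨⟨a f, hA f hf⟩, (AlgHom.mem_equalizer _ _ _).2 (DFunLike.congr_fun hx ⟨f, hf⟩), rfl⟩
        · rintro _ ⟨f, hf, rfl⟩
          exact ⟨⟨b f, hB f hf⟩, (AlgHom.mem_equalizer _ _ _).2 (DFunLike.congr_fun hy ⟨f, hf⟩), rfl⟩
      refine AlgHom.ext fun f => ?_
      obtain ⟨g, hg, hgf⟩ := key f.2
      obtain rfl : g = f := Subtype.ext hgf
      exact hg

/-- The Zariski topology: the open sets are the complements of the common zero sets of families of
regular functions. -/
abbrev zariskiTopology (K : Type*) [Field K] (X : Type*) [AffineVariety K X] : TopologicalSpace X where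
  IsOpen U := ∃ S ⊆ (coordRing (K := K) (X := X) : Set (X → K)), U = {x | ∀ f ∈ S, f x = 0}ᶜ
  isOpen_univ := ⟨{1}, by simp, by ext; simp⟩
  isOpen_inter := by
    rintro _ _ ⟨S, hS, rfl⟩ ⟨T, hT, rfl⟩
    refine ⟨{h | ∃ f ∈ S, ∃ g ∈ T, h = f * g}, ?_, ?_⟩
    · rintro _ ⟨f, hf, g, hg, rfl⟩
      exact mul_mem (hS hf) (hT hg)
    · ext x
      simp only [Set.mem_inter_iff, Set.mem_compl_iff, Set.mem_ofPred_eq, not_forall]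
      constructor
      · rintro ⟨⟨f, hf, hfx⟩, g, hg, hgx⟩
        exact ⟨f * g, ⟨f, hf, g, hg, rfl⟩, mul_ne_zero hfx hgx⟩
      · rintro ⟨_, ⟨f, hf, g, hg, rfl⟩, h⟩
        exact ⟨⟨f, hf, left_ne_zero_of_mul h⟩, g, hg, right_ne_zero_of_mul h⟩
  isOpen_sUnion := by
    intro s hs
    choose! S hS hU using hs
    refine ⟨⋃ U ∈ s, S U, Set.iUnion₂_subset hS, ?_⟩
    ext x
    simp only [Set.mem_sUnion, Set.mem_compl_iff, Set.mem_ofPred_eq, not_forall, Set.mem_iUnion]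
    constructor
    · rintro ⟨U, hUs, hx⟩
      rw [hU U hUs] at hx
      simp only [Set.mem_compl_iff, Set.mem_ofPred_eq, not_forall] at hx
      obtain ⟨f, hf, hfx⟩ := hx
      exact ⟨f, ⟨U, hUs, hf⟩, hfx⟩
    · rintro ⟨f, ⟨U, hUs, hf⟩, hfx⟩
      refine ⟨U, hUs, ?_⟩
      rw [hU U hUs]
      exact fun h => hfx (h f hf)

/-- An algebraic map (morphism) of affine varieties: a map that pulls regular functions back to
regular functions. -/
def IsAlgebraicMap (K : Type*) [Field K] {X Y : Type*} [AffineVariety K X] [AffineVariety K Y]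
    (φ : X → Y) : Prop :=
  ∀ h ∈ coordRing (K := K) (X := Y), h ∘ φ ∈ coordRing (K := K) (X := X)

/-- A function on a subset `U` of `X` (open in all uses) is regular if near every point of `U` it is
a quotient `a / b` of regular functions on `X` whose denominator has no zero there. -/
def IsRegularOn (K : Type*) [Field K] {X : Type*} [AffineVariety K X] (U : Set X) (φ : U → K) :
    Prop :=
  ∀ u : U, ∃ W : Set X, @IsOpen X (zariskiTopology K X) W ∧ u.1 ∈ W ∧ W ⊆ U ∧
    ∃ a ∈ coordRing (K := K) (X := X), ∃ b ∈ coordRing (K := K) (X := X),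
      ∀ v : U, v.1 ∈ W → b v.1 ≠ 0 ∧ φ v = a v.1 / b v.1

/-- A rational map `X ⇢ Y`: a morphism of varieties to `Y` from a dense open subset `dom` of `X`.
The largest possible domain is one allowed choice of `dom`. -/
structure RationalMap (K : Type*) [Field K] (X Y : Type*) [AffineVariety K X]
    [AffineVariety K Y] where
  /-- The domain of definition. -/
  dom : Set X
  isOpen_dom : @IsOpen X (zariskiTopology K X) dom
  dense_dom : @Dense X (zariskiTopology K X) dom
  /-- The values on the domain. -/
  toFun : dom → Y
  regular : ∀ h ∈ coordRing (K := K) (X := Y), IsRegularOn K dom (h ∘ toFun)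

/-- `G` is an algebraic group (affine and reduced): its multiplication and its inversion are
algebraic maps. -/
class IsAlgebraicGroup (K : Type*) [Field K] (G : Type*) [Group G] [AffineVariety K G] : Prop where
  mul : IsAlgebraicMap K (fun p : G × G => p.1 * p.2)
  inv : IsAlgebraicMap K (fun x : G => x⁻¹)

/-- `H` is a commutative algebraic group (affine and reduced), written additively. -/
class IsAlgebraicAddCommGroup (K : Type*) [Field K] (H : Type*) [AddCommGroup H]
    [AffineVariety K H] : Prop where
  add : IsAlgebraicMap K (fun p : H × H => p.1 + p.2)
  neg : IsAlgebraicMap K (fun x : H => -x)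

/-- `G` is connected in its Zariski topology. -/
def IsZariskiConnected (K : Type*) [Field K] (G : Type*) [AffineVariety K G] : Prop :=
  @ConnectedSpace G (zariskiTopology K G)

end AffineVariety

/-!
Since `f` is a cocycle where it is defined, `f (x * c) - x • f c` does not depend on the point `c`
as long as `c` and `x * c` lie in `dom f`; its value is the extension `F x`, and `F` is a crossed
homomorphism because finitely many translates of the dense open set `dom f` always meet.

To see that `F` is a morphism, let `φ = h ∘ F` with `h` regular on `H`. Expanding the regular
function `h (s + x • t)` of `((x, s), t)` as a finite sum of products shows that all the right
translates `x ↦ φ (x * y)` are linear combinations of finitely many functions that are regular near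
a point of `dom f`. Hence the ideal of common denominators of these translates is nonzero. It is
invariant under right translation, and a nonzero translation invariant ideal of `K[G]` is the unit
ideal: the translates of one of its elements `b` expand as `b (x * y) = ∑ aᵢ(x) cᵢ(y)` with all `aᵢ`
in the ideal, so substituting `y = x⁻¹ * z` exhibits the constant `b z` as an element of the ideal.
-/

theorem exists_forall_mem_and_sum_smul_eq {K V ι Y : Type*} [DivisionRing K] [AddCommGroup V]
    [Module K V] [Fintype ι] {W : Submodule K V} {a : ι → V} {c : Y → ι → K}
    (h : ∀ y, ∑ i, c y i • a i ∈ W) :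
    ∃ a' : ι → V, (∀ i, a' i ∈ W) ∧ ∀ y, ∑ i, c y i • a' i = ∑ i, c y i • a i := by
  classical
  let T : (ι → K) →ₗ[K] V := Fintype.linearCombination K a
  let S : Submodule K (ι → K) := .span K (Set.range c)
  have hTS : S ≤ W.comap T := Submodule.span_le.2 (Set.range_subset_iff.2 h)
  -- Composing `T` with a projection onto the span of the coefficient vectors `c y` moves the new
  -- coefficients `a' i` into `W` without changing the value of `T` at any `c y`.
  obtain ⟨P, hP⟩ := S.subtype.exists_leftInverse_of_injective S.ker_subtype
  let T' : (ι → K) →ₗ[K] V := T ∘ₗ S.subtype ∘ₗ P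
  refine ⟨fun i => T' fun j => if i = j then 1 else 0, fun i => hTS (P _).2, fun y => ?_⟩
  have hPc : P (c y) = ⟨c y, Submodule.subset_span ⟨y, rfl⟩⟩ := LinearMap.congr_fun hP ⟨c y, _⟩
  calc ∑ i, c y i • T' (fun j => if i = j then 1 else 0)
      = T' (c y) := (T'.pi_apply_eq_sum_univ (c y)).symm
    _ = T (c y) := congrArg (fun s : S => T s) hPc

/-- A set is right thick if it contains a right translate of every finite subset of the group. -/
def IsRightThick {G : Type*} [Mul G] (U : Set G) : Prop :=
  ∀ T : Finset G, ∃ c, ∀ g ∈ T, g * c ∈ U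

theorem isRightThick_of_isOpen_of_dense {G : Type*} [Group G] [TopologicalSpace G]
    [ContinuousConstSMul G G] {U : Set G} (hU : IsOpen U) (hd : Dense U) : IsRightThick U := by
  intro T
  have hdense : Dense (⋂₀ ((fun g => (g • ·) ⁻¹' U) '' (T : Set G))) :=
    (T.finite_toSet.image _).dense_sInter
      (Set.forall_mem_image.2 fun g _ => hU.preimage (continuous_const_smul g))
      (Set.forall_mem_image.2 fun g _ => hd.preimage (isOpenMap_smul g))
  obtain ⟨c, hc⟩ := hdense.nonempty
  exact ⟨c, fun g hg => hc _ ⟨g, hg, rfl⟩⟩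

/-- The cocycle (crossed homomorphism) identity for a function on a group, required only where all
three points at which the function is evaluated lie in `U`; the values off `U` are irrelevant. -/
def IsCocycle₁On {G A : Type*} [Mul G] [Add A] [SMul G A] (U : Set G) (f : G → A) : Prop :=
  ∀ x ∈ U, ∀ y ∈ U, x * y ∈ U → f (x * y) = x • f y + f x

namespace IsCocycle₁On

variable {G A : Type*} [Group G] [AddCommGroup A] [DistribMulAction G A] {U : Set G} {f : G → A}

theorem sub_smul_eq_of_inv_mul_mem (hf : IsCocycle₁On U f) {x c d : G} (hc : c ∈ U)
    (hxc : x * c ∈ U) (hd : d ∈ U) (hxd : x * d ∈ U) (hcd : c⁻¹ * d ∈ U) :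
    f (x * c) - x • f c = f (x * d) - x • f d := by
  have hfd : f d = c • f (c⁻¹ * d) + f c := by
    simpa only [mul_inv_cancel_left] using hf c hc (c⁻¹ * d) hcd (by simpa using hd)
  have hfxd : f (x * d) = (x * c) • f (c⁻¹ * d) + f (x * c) := by
    simpa only [mul_assoc, mul_inv_cancel_left] using
      hf (x * c) hxc (c⁻¹ * d) hcd (by simpa [mul_assoc] using hxd)
  rw [hfd, hfxd, smul_add, smul_smul]
  abel

theorem sub_smul_eq (hf : IsCocycle₁On U f) (hU : IsRightThick U) {x c d : G} (hc : c ∈ U)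
    (hxc : x * c ∈ U) (hd : d ∈ U) (hxd : x * d ∈ U) :
    f (x * c) - x • f c = f (x * d) - x • f d := by
  classical
  obtain ⟨e, he⟩ := hU {1, x, c⁻¹, d⁻¹}
  simp only [Finset.mem_insert, Finset.mem_singleton, forall_eq_or_imp, forall_eq, one_mul] at he
  obtain ⟨he, hxe, hce, hde⟩ := he
  rw [hf.sub_smul_eq_of_inv_mul_mem hc hxc he hxe hce,
    hf.sub_smul_eq_of_inv_mul_mem hd hxd he hxe hde]

theorem exists_isCocycle₁_eqOn (hf : IsCocycle₁On U f) (hU : IsRightThick U) :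
    ∃ F : G → A, groupCohomology.IsCocycle₁ F ∧ U.EqOn F f := by
  classical
  have hex : ∀ x, ∃ c, c ∈ U ∧ x * c ∈ U := fun x => by
    simpa only [Finset.mem_insert, Finset.mem_singleton, forall_eq_or_imp, forall_eq, one_mul]
      using hU {1, x}
  choose c hc hxc using hex
  let F : G → A := fun x => f (x * c x) - x • f (c x)
  have hF : ∀ x d, d ∈ U → x * d ∈ U → F x = f (x * d) - x • f d :=
    fun x d hd hxd => hf.sub_smul_eq hU (hc x) (hxc x) hd hxd
  refine ⟨F, fun x y => ?_, fun x hx => ?_⟩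
  · obtain ⟨d, hd⟩ := hU {1, y, x * y}
    simp only [Finset.mem_insert, Finset.mem_singleton, forall_eq_or_imp, forall_eq, one_mul] at hd
    obtain ⟨hd, hyd, hxyd⟩ := hd
    rw [hF (x * y) d hd hxyd, hF y d hd hyd, hF x (y * d) hyd (by rwa [← mul_assoc]), smul_sub,
      smul_smul, mul_assoc]
    abel
  · rw [hF x (c x) (hc x) (hxc x), hf x hx (c x) (hc x) (hxc x), add_sub_cancel_left]

end IsCocycle₁On

namespace AffineVariety

variable {K : Type*} [Field K] {X Y Z : Type*} [AffineVariety K X] [AffineVariety K Y]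
  [AffineVariety K Z]

local notation "𝒪(" V ")" => coordRing (K := K) (X := V)

theorem comp_prodMk_mem {S : Type*} {R : Subalgebra K (S → K)} {φ : S → X} {ψ : S → Y}
    (hφ : ∀ h ∈ 𝒪(X), h ∘ φ ∈ R) (hψ : ∀ h ∈ 𝒪(Y), h ∘ ψ ∈ R) {h : X × Y → K}
    (hh : h ∈ 𝒪(X × Y)) : (fun s => h (φ s, ψ s)) ∈ R := by
  suffices hle : 𝒪(X × Y) ≤
      R.comap (AlgHom.pi fun s : S => Pi.evalAlgHom K (fun _ : X × Y => K) (φ s, ψ s)) from hle hh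
  refine sup_le ?_ ?_
  · rintro _ ⟨g, hg, rfl⟩
    exact hφ g hg
  · rintro _ ⟨g, hg, rfl⟩
    exact hψ g hg

theorem exists_eq_sum_mul_of_mem_coordRing_prod {h : X × Y → K} (hh : h ∈ 𝒪(X × Y)) :
    ∃ (n : ℕ) (a : Fin n → 𝒪(X)) (c : Fin n → 𝒪(Y)),
      ∀ x y, h (x, y) = ∑ i, (a i).1 x * (c i).1 y := by
  replace hh : h ∈ Subalgebra.toSubmodule (_ ⊔ _) := hh
  rw [← Subalgebra.mul_toSubmodule] at hh
  induction hh using Submodule.mul_induction_on' with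
  | mem_mul_mem _ ha _ hc =>
    obtain ⟨a, ha, rfl⟩ := ha
    obtain ⟨c, hc, rfl⟩ := hc
    exact ⟨1, fun _ => ⟨a, ha⟩, fun _ => ⟨c, hc⟩, fun x y => by rw [Fin.sum_univ_one]; rfl⟩
  | add h₁ _ h₂ _ ih₁ ih₂ =>
    obtain ⟨n₁, a₁, c₁, h₁_eq⟩ := ih₁
    obtain ⟨n₂, a₂, c₂, h₂_eq⟩ := ih₂
    refine ⟨n₁ + n₂, Fin.append a₁ a₂, Fin.append c₁ c₂, fun x y => ?_⟩
    simp only [Pi.add_apply, h₁_eq, h₂_eq, Fin.sum_univ_add, Fin.append_left, Fin.append_right]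

namespace IsAlgebraicMap

theorem id : IsAlgebraicMap K (fun x : X => x) := fun _ hh => hh

theorem const (y : Y) : IsAlgebraicMap K (fun _ : X => y) :=
  fun h _ => 𝒪(X).algebraMap_mem (h y)

theorem fst : IsAlgebraicMap K (Prod.fst : X × Y → X) :=
  fun h hh => (le_sup_left : _ ≤ 𝒪(X × Y)) ⟨h, hh, rfl⟩

theorem snd : IsAlgebraicMap K (Prod.snd : X × Y → Y) :=
  fun h hh => (le_sup_right : _ ≤ 𝒪(X × Y)) ⟨h, hh, rfl⟩

theorem comp {φ : Y → Z} {ψ : X → Y} (hφ : IsAlgebraicMap K φ) (hψ : IsAlgebraicMap K ψ) :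
    IsAlgebraicMap K (fun x => φ (ψ x)) :=
  fun h hh => hψ _ (hφ h hh)

theorem prodMk {φ : Z → X} {ψ : Z → Y} (hφ : IsAlgebraicMap K φ) (hψ : IsAlgebraicMap K ψ) :
    IsAlgebraicMap K fun z => (φ z, ψ z) :=
  fun _ hh => comp_prodMk_mem hφ hψ hh

theorem continuous {φ : X → Y} (hφ : IsAlgebraicMap K φ) :
    @Continuous X Y (zariskiTopology K X) (zariskiTopology K Y) φ := by
  let _ := zariskiTopology K X
  let _ := zariskiTopology K Y
  refine ⟨?_⟩
  rintro _ ⟨S, hS, rfl⟩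
  refine ⟨(· ∘ φ) '' S, Set.image_subset_iff.2 fun g hg => hφ g (hS hg), ?_⟩
  ext x
  simp

/-- The homomorphism of coordinate rings `h ↦ h ∘ φ` induced by an algebraic map `φ`. -/
def comorphism {φ : X → Y} (hφ : IsAlgebraicMap K φ) : 𝒪(Y) →ₐ[K] 𝒪(X) where
  toFun h := ⟨h.1 ∘ φ, hφ h.1 h.2⟩
  map_one' := rfl
  map_mul' _ _ := rfl
  map_zero' := rfl
  map_add' _ _ := rfl
  commutes' _ := rfl

@[simp]
theorem coe_comorphism_apply {φ : X → Y} (hφ : IsAlgebraicMap K φ) (h : 𝒪(Y)) (x : X) :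
    (hφ.comorphism h).1 x = h.1 (φ x) := rfl

end IsAlgebraicMap

/-- The local ring of `X` at `x`, realized by globally defined functions: those which become regular
on `X` after multiplication by a regular function that does not vanish at `x`. Their values
outside some neighbourhood of `x` are unconstrained. -/
def regularAt (K : Type*) [Field K] {X : Type*} [AffineVariety K X] (x : X) :
    Subalgebra K (X → K) where
  carrier := {φ | ∃ b ∈ coordRing (K := K) (X := X), b x ≠ 0 ∧ b * φ ∈ coordRing (K := K) (X := X)}
  mul_mem' := by
    rintro φ ψ ⟨b, hb, hbx, hφ⟩ ⟨c, hc, hcx, hψ⟩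
    refine ⟨b * c, mul_mem hb hc, mul_ne_zero hbx hcx, ?_⟩
    rw [mul_mul_mul_comm]
    exact mul_mem hφ hψ
  add_mem' := by
    rintro φ ψ ⟨b, hb, hbx, hφ⟩ ⟨c, hc, hcx, hψ⟩
    refine ⟨b * c, mul_mem hb hc, mul_ne_zero hbx hcx, ?_⟩
    have hsum : b * c * (φ + ψ) = c * (b * φ) + b * (c * ψ) := by ring
    rw [hsum]
    exact add_mem (mul_mem hc hφ) (mul_mem hb hψ)
  algebraMap_mem' r :=
    ⟨1, one_mem _, one_ne_zero, by rw [one_mul]; exact Subalgebra.algebraMap_mem _ r⟩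

theorem coordRing_le_regularAt (x : X) : 𝒪(X) ≤ regularAt K x :=
  fun φ hφ => ⟨1, one_mem _, one_ne_zero, by rwa [one_mul]⟩

theorem exists_ne_zero_of_isOpen {W : Set X} (hW : @IsOpen X (zariskiTopology K X) W) {x : X}
    (hx : x ∈ W) : ∃ b ∈ 𝒪(X), b x ≠ 0 ∧ ∀ y, b y ≠ 0 → y ∈ W := by
  obtain ⟨S, hS, rfl⟩ := hW
  simp only [Set.mem_compl_iff, Set.mem_ofPred_eq, not_forall] at hx ⊢
  obtain ⟨b, hb, hbx⟩ := hx
  exact ⟨b, hS hb, hbx, fun y hy => ⟨b, hb, hy⟩⟩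

theorem mem_regularAt_of_eqOn_div {W : Set X} (hW : @IsOpen X (zariskiTopology K X) W) {x : X}
    (hx : x ∈ W) {a b φ : X → K} (ha : a ∈ 𝒪(X)) (hb : b ∈ 𝒪(X)) (hb₀ : ∀ y ∈ W, b y ≠ 0)
    (hφ : W.EqOn φ (a / b)) : φ ∈ regularAt K x := by
  obtain ⟨d, hd, hdx, hdW⟩ := exists_ne_zero_of_isOpen hW hx
  refine ⟨d * b, mul_mem hd hb, mul_ne_zero hdx (hb₀ x hx), ?_⟩
  have hclear : d * b * φ = d * a := by
    ext y
    by_cases hdy : d y = 0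
    · simp [hdy]
    · have hyW := hdW y hdy
      simp only [Pi.mul_apply, hφ hyW, Pi.div_apply, mul_assoc, mul_div_cancel₀ _ (hb₀ y hyW)]
  rw [hclear]
  exact mul_mem hd ha

theorem IsRegularOn.mem_regularAt {U : Set X} {φ : U → K} (hφ : IsRegularOn K U φ) {ψ : X → K}
    (h : ∀ u : U, ψ u = φ u) (x : U) : ψ ∈ regularAt K x.1 := by
  obtain ⟨W, hW, hxW, hWU, a, ha, b, hb, hab⟩ := hφ x
  exact mem_regularAt_of_eqOn_div hW hxW ha hb (fun y hy => (hab ⟨y, hWU hy⟩ hy).1)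
    fun y hy => (h ⟨y, hWU hy⟩).trans (hab ⟨y, hWU hy⟩ hy).2

theorem exists_common_denominator {ι : Type*} [Finite ι] {x : X} {φ : ι → X → K}
    (hφ : ∀ i, φ i ∈ regularAt K x) : ∃ b ∈ 𝒪(X), b x ≠ 0 ∧ ∀ i, b * φ i ∈ 𝒪(X) := by
  classical
  have := Fintype.ofFinite ι
  choose b hb hbx hbφ using hφ
  refine ⟨∏ i, b i, prod_mem fun i _ => hb i, ?_, fun i => ?_⟩
  · rw [Finset.prod_apply]
    exact Finset.prod_ne_zero_iff.2 fun i _ => hbx i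
  · rw [← Finset.prod_erase_mul _ _ (Finset.mem_univ i), mul_assoc]
    exact mul_mem (prod_mem fun j _ => hb j) (hbφ i)

/-- The ideal of common denominators of a set `S` of functions on `X`: the regular functions `b`
for which `b * φ` is regular for every `φ ∈ S`. -/
def denominatorIdeal (K : Type*) [Field K] {X : Type*} [AffineVariety K X] (S : Set (X → K)) :
    Ideal (coordRing (K := K) (X := X)) :=
  (1 : Submodule (coordRing (K := K) (X := X)) (X → K)).colon S

theorem mem_denominatorIdeal {S : Set (X → K)} {b : 𝒪(X)} :
    b ∈ denominatorIdeal K S ↔ ∀ φ ∈ S, b.1 * φ ∈ 𝒪(X) := by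
  refine Submodule.mem_colon.trans (forall₂_congr fun φ _ => Submodule.mem_one.trans ?_)
  exact ⟨fun ⟨a, ha⟩ => (show a.1 = b.1 * φ from ha) ▸ a.2, fun h => ⟨⟨_, h⟩, rfl⟩⟩

section Group

variable {G : Type*} [Group G] [AffineVariety K G] [IsAlgebraicGroup K G]

theorem isAlgebraicMap_mul_left (g : G) : IsAlgebraicMap K (fun x : G => g * x) :=
  (IsAlgebraicGroup.mul (K := K) (G := G)).comp ((IsAlgebraicMap.const g).prodMk .id)

theorem isAlgebraicMap_mul_right (g : G) : IsAlgebraicMap K (fun x : G => x * g) :=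
  (IsAlgebraicGroup.mul (K := K) (G := G)).comp (IsAlgebraicMap.id.prodMk (.const g))

theorem isAlgebraicMap_inv_mul (g : G) : IsAlgebraicMap K (fun x : G => x⁻¹ * g) :=
  (isAlgebraicMap_mul_right g).comp IsAlgebraicGroup.inv

theorem continuousConstSMul_zariskiTopology (K : Type*) [Field K] (G : Type*) [Group G]
    [AffineVariety K G] [IsAlgebraicGroup K G] :
    @ContinuousConstSMul G G (zariskiTopology K G) _ :=
  letI := zariskiTopology K G
  ⟨fun g => (isAlgebraicMap_mul_left g).continuous⟩

theorem ideal_eq_top_of_mul_right_invariant {I : Ideal 𝒪(G)} (hI : I ≠ ⊥)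
    (hinv : ∀ g, ∀ b ∈ I, (isAlgebraicMap_mul_right g).comorphism b ∈ I) : I = ⊤ := by
  obtain ⟨b, hbI, hb⟩ := Submodule.exists_mem_ne_zero_of_ne_bot hI
  obtain ⟨z, hbz⟩ : ∃ z, b.1 z ≠ 0 := Function.ne_iff.1 (Subtype.coe_ne_coe.2 hb)
  obtain ⟨n, a, c, hac⟩ :=
    exists_eq_sum_mul_of_mem_coordRing_prod (IsAlgebraicGroup.mul (K := K) (G := G) b.1 b.2)
  have htranslate (y : G) :
      ∑ i, (c i).1 y • a i = (isAlgebraicMap_mul_right (K := K) y).comorphism b := by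
    ext x
    simpa [mul_comm] using (hac x y).symm
  obtain ⟨a', ha'I, ha'⟩ := exists_forall_mem_and_sum_smul_eq (W := I.restrictScalars K)
    (a := a) (c := fun y i => (c i).1 y) fun y => (htranslate y).symm ▸ hinv y b hbI
  have hsum : ∑ i, a' i * (isAlgebraicMap_inv_mul z).comorphism (c i) =
      algebraMap K 𝒪(G) (b.1 z) := by
    ext x
    have hx := congrArg (fun h : 𝒪(G) => h.1 x) ((ha' (x⁻¹ * z)).trans (htranslate (x⁻¹ * z)))
    simpa [mul_comm] using hx
  refine I.eq_top_of_isUnit_mem (hsum ▸ sum_mem fun i _ => I.mul_mem_right _ (ha'I i)) ?_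
  exact (IsUnit.mk0 _ hbz).map (algebraMap K 𝒪(G))

theorem comorphism_mul_right_mem_denominatorIdeal {S : Set (G → K)}
    (hS : ∀ g, ∀ φ ∈ S, (fun x => φ (x * g)) ∈ S) {b : 𝒪(G)} (hb : b ∈ denominatorIdeal K S)
    (g : G) : (isAlgebraicMap_mul_right g).comorphism b ∈ denominatorIdeal K S := by
  rw [mem_denominatorIdeal] at hb ⊢
  intro φ hφ
  have hmul : (fun x => b.1 (x * g) * φ (x * g * g⁻¹)) ∈ 𝒪(G) :=
    isAlgebraicMap_mul_right g _ (hb _ (hS g⁻¹ φ hφ))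
  simp only [mul_inv_cancel_right] at hmul
  exact hmul

theorem mem_coordRing_of_mul_eq_sum {ι : Type*} [Fintype ι] {φ : G → K} {u q : ι → G → K} {x₀ : G}
    (hu : ∀ i, u i ∈ regularAt K x₀) (hφ : ∀ x y, φ (x * y) = ∑ i, u i x * q i y) :
    φ ∈ 𝒪(G) := by
  let translates : Set (G → K) := Set.range fun y x => φ (x * y)
  obtain ⟨b, hb, hbx₀, hbu⟩ := exists_common_denominator hu
  have hb_mem : ⟨b, hb⟩ ∈ denominatorIdeal K translates := by
    rw [mem_denominatorIdeal]
    rintro _ ⟨y, rfl⟩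
    have hsum : b * (fun x => φ (x * y)) = ∑ i, q i y • (b * u i) := by
      ext x
      simp only [Pi.mul_apply, hφ, Finset.mul_sum, Finset.sum_apply, Pi.smul_apply, smul_eq_mul]
      exact Finset.sum_congr rfl fun i _ => by ring
    rw [hsum]
    exact sum_mem fun i _ => 𝒪(G).smul_mem (hbu i) _
  have hne : denominatorIdeal K translates ≠ ⊥ :=
    Submodule.ne_bot_iff _ |>.2 ⟨_, hb_mem, fun h => hbx₀ (congrFun (congrArg Subtype.val h) x₀)⟩
  have htop := ideal_eq_top_of_mul_right_invariant hne fun g d hd =>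
    comorphism_mul_right_mem_denominatorIdeal
      (by rintro g _ ⟨y, rfl⟩; exact ⟨g * y, by simp only [mul_assoc]⟩) hd g
  have hφ_one := mem_denominatorIdeal.1 ((Ideal.eq_top_iff_one _).1 htop) _ ⟨1, rfl⟩
  simpa only [OneMemClass.coe_one, one_mul, mul_one] using hφ_one

theorem isAlgebraicMap_of_isCocycle₁ {H : Type*} [AddCommGroup H] [AffineVariety K H]
    [IsAlgebraicAddCommGroup K H] [SMul G H] (hρ : IsAlgebraicMap K fun p : G × H => p.1 • p.2)
    {F : G → H} (hF : groupCohomology.IsCocycle₁ F) {x₀ : G}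
    (hreg : ∀ k ∈ 𝒪(H), k ∘ F ∈ regularAt K x₀) : IsAlgebraicMap K F := by
  intro h hh
  have hadd_smul : IsAlgebraicMap K fun p : (G × H) × H => p.1.1 • p.2 + p.1.2 :=
    (IsAlgebraicAddCommGroup.add (K := K) (H := H)).comp
      ((hρ.comp ((IsAlgebraicMap.fst.comp .fst).prodMk .snd)).prodMk
        (IsAlgebraicMap.snd.comp .fst))
  obtain ⟨n, p, q, hpq⟩ := exists_eq_sum_mul_of_mem_coordRing_prod (hadd_smul h hh)
  refine mem_coordRing_of_mul_eq_sum (u := fun i x => (p i).1 (x, F x))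
    (q := fun i y => (q i).1 (F y)) (x₀ := x₀) (fun i => ?_) fun x y => ?_
  · exact comp_prodMk_mem (coordRing_le_regularAt x₀) hreg (p i).2
  · rw [Function.comp_apply, hF x y]
    exact hpq (x, F x) (F y)

end Group

end AffineVariety

/-- Over an arbitrary field `K`, an `AffineVariety K X` identifies `X` with the set of common zeros
in some `Kⁿ` of a family of polynomials, so its points are the `K`-rational ones. -/
theorem mainTheorem7_general {K : Type*} [Field K]
    {G : Type*} [Group G] [AffineVariety K G] [AffineVariety.IsAlgebraicGroup K G]
    {H : Type*} [AddCommGroup H] [AffineVariety K H] [AffineVariety.IsAlgebraicAddCommGroup K H]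
    [DistribMulAction G H]
    (hρ : AffineVariety.IsAlgebraicMap K (fun p : G × H => p.1 • p.2))
    (f : AffineVariety.RationalMap K G H)
    (hf : ∀ (x y : G) (hx : x ∈ f.dom) (hy : y ∈ f.dom) (hxy : x * y ∈ f.dom),
      f.toFun ⟨x * y, hxy⟩ = f.toFun ⟨x, hx⟩ + x • f.toFun ⟨y, hy⟩) :
    ∃ F : G → H, AffineVariety.IsAlgebraicMap K F ∧
      (∀ x : f.dom, F x = f.toFun x) ∧
      ∀ x y : G, F (x * y) = F x + x • F y := by
  let _ := AffineVariety.zariskiTopology K G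
  have _ := AffineVariety.continuousConstSMul_zariskiTopology K G
  let f₀ : G → H := Function.extend Subtype.val f.toFun 0
  have hf₀ (x : f.dom) : f₀ x = f.toFun x := Subtype.val_injective.extend_apply _ _ x
  have hf₀_cocycle : IsCocycle₁On f.dom f₀ := fun x hx y hy hxy => by
    rw [hf₀ ⟨x * y, hxy⟩, hf₀ ⟨x, hx⟩, hf₀ ⟨y, hy⟩, hf x y hx hy hxy, add_comm]
  obtain ⟨F, hF, hFf₀⟩ := hf₀_cocycle.exists_isCocycle₁_eqOn
    (isRightThick_of_isOpen_of_dense f.isOpen_dom f.dense_dom)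
  have hFf (x : f.dom) : F x = f.toFun x := (hFf₀ x.2).trans (hf₀ x)
  obtain ⟨x₀, hx₀⟩ := f.dense_dom.nonempty
  have hreg (k : H → K) (hk : k ∈ AffineVariety.coordRing) : k ∘ F ∈ AffineVariety.regularAt K x₀ :=
    (f.regular k hk).mem_regularAt (fun x => congrArg k (hFf x)) ⟨x₀, hx₀⟩
  exact ⟨F, AffineVariety.isAlgebraicMap_of_isCocycle₁ hρ hF hreg, hFf,
    fun x y => (hF x y).trans (add_comm _ _)⟩

/-- `DistribMulAction G H` is an action of the group `G` on `H` by group automorphisms. -/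
theorem mainTheorem7 {K : Type*} [Field K] [IsAlgClosed K]
    {G : Type*} [Group G] [AffineVariety K G] [AffineVariety.IsAlgebraicGroup K G]
    (hG : AffineVariety.IsZariskiConnected K G)
    {H : Type*} [AddCommGroup H] [AffineVariety K H] [AffineVariety.IsAlgebraicAddCommGroup K H]
    [DistribMulAction G H]
    (hρ : AffineVariety.IsAlgebraicMap K (fun p : G × H => p.1 • p.2))
    (f : AffineVariety.RationalMap K G H)
    (hf : ∀ (x y : G) (hx : x ∈ f.dom) (hy : y ∈ f.dom) (hxy : x * y ∈ f.dom),
      f.toFun ⟨x * y, hxy⟩ = f.toFun ⟨x, hx⟩ + x • f.toFun ⟨y, hy⟩) :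
    ∃ F : G → H, AffineVariety.IsAlgebraicMap K F ∧
      (∀ x : f.dom, F x = f.toFun x) ∧
      ∀ x y : G, F (x * y) = F x + x • F y :=
  mainTheorem7_general hρ f hf
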